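/- For complex numbers $a,b$ with $\operatorname{Re} a>0$ and $\operatorname{Re} b<2$, and for $x>0$, let $$U(a,b,x)=\frac{1}{\Gamma(a)}\int_0^\infty t^{a-1}e^{-xt}(1+t)^{b-a-1}\,dt$$ be the Tricomi function, and for $\mu\in\mathbb C$ let $$J(a,b;\mu)=\int_0^\infty e^{-\mu x}\,U(a,b,x)\,dx .$$ All complex powers are principal, $1/\Gamma$ is taken to be $0$ at the poles of $\Gamma$, and $0^{s}=0$ for $s\ne 0$. 1. Suppose that $a\notin\{1,2,3,\dots\}$, that $|\mu|<1$, and that either $\operatorname{Re}\mu>0$, or $\operatorname{Re}\mu=0$ and $\operatorname{Re} a>1$. Then the integral defining $J(a,b;\mu)$ converges absolutely and $$J(a,b;\mu)=\frac{\Gamma(2-b)}{(a-1)\,\Gamma(1+a-b)}\;{}_2F_1(1,\,2-b;\,2-a;\,\mu)+\frac{\mu^{a-1}\,\Gamma(1-a)}{(1-\mu)^{1+a-b}} .$$ 2. For $\mu=1$ the integral converges absolutely and $$J(a,b;1)=\frac{\Gamma(2-b)}{\Gamma(2-b+a)} .$$ 3. In the special case $a=k$, a positive integer, $$J(k,b;1)=\frac{1}{(2-b)_k},\qquad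 (c)_k=c(c+1)\cdots(c+k-1).$$ -/

import Mathlib

open MeasureTheory Set

noncomputable section

/-- The Tricomi confluent hypergeometric function
`U(a, b, x) = (1 / Γ(a)) ∫_0^∞ t^(a-1) e^(-x t) (1 + t)^(b-a-1) dt`,
for complex parameters `a`, `b` with `Re a > 0` and for `x > 0`; the powers of the positive numbers
`t` and `1 + t` are the principal ones. -/
def tricomiU (a b : ℂ) (x : ℝ) : ℂ :=
  1 / Complex.Gamma a *
    ∫ t in Ioi (0 : ℝ),
      (t : ℂ) ^ (a - 1) * Complex.exp (-((x : ℂ) * (t : ℂ))) * (1 + (t : ℂ)) ^ (b - a - 1)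

/-- `J(a, b; μ) = ∫_0^∞ e^(-μ x) U(a, b, x) dx`. -/
def tricomiJ (a b μ : ℂ) : ℂ :=
  ∫ x in Ioi (0 : ℝ), Complex.exp (-(μ * (x : ℂ))) * tricomiU a b x

/-- The integral that defines `J(a, b; μ)` converges absolutely. -/
def TricomiJConverges (a b μ : ℂ) : Prop :=
  IntegrableOn (fun x : ℝ => Complex.exp (-(μ * (x : ℂ))) * tricomiU a b x) (Ioi (0 : ℝ))

end

open MeasureTheory Set Filter Topology

/-! Put c = 2 - b. Integrating over x first (Fubini) turns Γ(a) J into the Stieltjes transform S(μ)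
= ∫ t^(a-1) (1+t)^(1-a-c) / (t+μ) dt. At μ = 1 this is a beta integral, and parts 2 and 3 follow.

For part 1, integrating the derivative of t^a (1+t)^(1-a-c) / (t+μ) shows that S satisfies an
inhomogeneous first-order linear equation with singular points 0 and 1 (`stieltjesPow_deriv_eq`). A
constant multiple of ₂F₁(1, c; 2-a; μ) satisfies the same equation
(`ordinaryHypergeometric_one_left_deriv_eq`). Their difference is therefore K μ^(a-1) (1-μ)^(1-a-c)
on the right half of the unit disc (`exists_const_of_hasDerivAt`). For Re a < 2, scaling t = xs in
S'(x) as x → 0+ gives K = Γ(a) Γ(1-a) (`tendsto_cpow_mul_integral_powKernel_div_add_sq`). Contiguous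
relations under (a, c) ↦ (a-1, c+1) remove the bound on Re a, and a limit from the right half-plane
reaches Re μ = 0. -/

/-- The kernel `t ^ p * (1 + t) ^ q` of the beta integral of the second kind. -/
noncomputable def powKernel (p q : ℂ) (t : ℝ) : ℂ := (t : ℂ) ^ p * (1 + (t : ℂ)) ^ q

/-! ### Algebra and derivative of the kernel. -/

lemma one_add_ofReal_ne_zero {t : ℝ} (ht : 0 < t) : (1 + (t : ℂ)) ≠ 0 := by
  exact_mod_cast (by positivity : (1 + t) ≠ 0)

lemma one_add_ofReal_mem_slitPlane {t : ℝ} (ht : 0 < t) : (1 + (t : ℂ)) ∈ Complex.slitPlane := by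
  left; simp; linarith

lemma norm_powKernel (p q : ℂ) {t : ℝ} (ht : 0 < t) :
    ‖powKernel p q t‖ = t ^ p.re * (1 + t) ^ q.re := by
  rw [powKernel, norm_mul, Complex.norm_cpow_eq_rpow_re_of_pos ht]
  have h := Complex.norm_cpow_eq_rpow_re_of_pos (show 0 < 1 + t by positivity) q
  push_cast at h
  rw [h]

lemma mul_powKernel (p q : ℂ) {t : ℝ} (ht : 0 < t) :
    (t : ℂ) * powKernel p q t = powKernel (p + 1) q t := by
  rw [powKernel, powKernel, Complex.cpow_add _ _ (by exact_mod_cast ht.ne'), Complex.cpow_one]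
  ring

lemma one_add_mul_powKernel (p q : ℂ) {t : ℝ} (ht : 0 < t) :
    (1 + (t : ℂ)) * powKernel p q t = powKernel p (q + 1) t := by
  rw [powKernel, powKernel, Complex.cpow_add _ _ (one_add_ofReal_ne_zero ht), Complex.cpow_one]
  ring

lemma hasDerivAt_powKernel (p q : ℂ) {t : ℝ} (ht : 0 < t) :
    HasDerivAt (powKernel p q) (p * powKernel (p - 1) q t + q * powKernel p (q - 1) t) t := by
  have h1 : HasDerivAt (fun s : ℂ => s ^ p) (p * (t : ℂ) ^ (p - 1)) (t : ℂ) := by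
    simpa using (hasDerivAt_id (t : ℂ)).cpow_const (c := p) (Or.inl (by simpa using ht))
  have h2 : HasDerivAt (fun s : ℂ => (1 + s) ^ q) (q * (1 + (t : ℂ)) ^ (q - 1)) (t : ℂ) := by
    simpa using ((hasDerivAt_id (t : ℂ)).const_add 1).cpow_const (c := q)
      (one_add_ofReal_mem_slitPlane ht)
  refine (h1.mul h2).comp_ofReal.congr_deriv ?_
  rw [powKernel, powKernel]
  ring

lemma continuousOn_powKernel (p q : ℂ) : ContinuousOn (powKernel p q) (Ioi 0) :=
  fun _ ht => (hasDerivAt_powKernel p q ht).continuousAt.continuousWithinAt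

lemma aestronglyMeasurable_powKernel (p q : ℂ) :
    AEStronglyMeasurable (powKernel p q) (volume.restrict (Ioi 0)) :=
  (continuousOn_powKernel p q).aestronglyMeasurable measurableSet_Ioi

/-! ### The beta integral of the second kind. -/

lemma image_div_one_add_Ioi : (fun t : ℝ => t / (1 + t)) '' Ioi 0 = Ioo 0 1 := by
  ext x
  constructor
  · rintro ⟨t, ht, rfl⟩
    have ht' : 0 < t := ht
    exact ⟨by positivity, by rw [div_lt_one (by positivity)]; linarith⟩
  · rintro ⟨h0, h1⟩
    have : 0 < 1 - x := by linarith
    refine ⟨x / (1 - x), by simp only [mem_Ioi]; positivity, ?_⟩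
    field_simp
    ring

lemma injOn_div_one_add_Ioi : InjOn (fun t : ℝ => t / (1 + t)) (Ioi 0) := by
  intro s hs t ht h
  have hs' : (0 : ℝ) < s := hs
  have ht' : (0 : ℝ) < t := ht
  replace h : s / (1 + s) = t / (1 + t) := h
  rw [div_eq_div_iff (by positivity) (by positivity)] at h
  linarith

lemma hasDerivAt_div_one_add {t : ℝ} (ht : 0 < t) :
    HasDerivAt (fun t : ℝ => t / (1 + t)) (1 / (1 + t) ^ 2) t := by
  have h := (hasDerivAt_id t).div ((hasDerivAt_id t).const_add 1) (show 1 + id t ≠ 0 by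
    simp only [id]; positivity)
  refine h.congr_deriv ?_
  simp

/-- Since 1 - t/(1+t) = 1/(1+t), the powers of 1+t from the Jacobian and the two factors add up to
-2 - (u-1) - (v-1) = -(u+v). -/
lemma abs_deriv_smul_beta_integrand (u v : ℂ) {t : ℝ} (ht : 0 < t) :
    |1 / (1 + t) ^ 2| • (((t / (1 + t) : ℝ) : ℂ) ^ (u - 1) *
      (1 - ((t / (1 + t) : ℝ) : ℂ)) ^ (v - 1)) = powKernel (u - 1) (-(u + v)) t := by
  have h1 : (1 : ℂ) - ((t / (1 + t) : ℝ) : ℂ) = (((1 + t)⁻¹ : ℝ) : ℂ) := by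
    rw [← Complex.ofReal_one, ← Complex.ofReal_sub]
    congr 1
    field_simp
    ring
  have hp : (0 : ℝ) < 1 + t := by positivity
  have hne := one_add_ofReal_ne_zero ht
  rw [abs_of_pos (by positivity), h1, div_eq_mul_inv t, Complex.ofReal_mul,
    Complex.mul_cpow_ofReal_nonneg ht.le (inv_nonneg.2 hp.le), powKernel, Complex.real_smul]
  push_cast
  have harg : (1 + (t : ℂ)).arg ≠ Real.pi := by
    rw [← Complex.ofReal_one, ← Complex.ofReal_add, Complex.arg_ofReal_of_nonneg hp.le]
    exact Real.pi_pos.ne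
  rw [Complex.inv_cpow _ _ harg, Complex.inv_cpow _ _ harg, ← Complex.cpow_neg, ← Complex.cpow_neg]
  have h2 : (1 / (1 + (t : ℂ)) ^ 2) = (1 + (t : ℂ)) ^ (-2 : ℂ) := by
    rw [Complex.cpow_neg]
    norm_cast
    simp
  rw [h2, show -(u + v) = -2 + -(u - 1) + -(v - 1) by ring, Complex.cpow_add _ _ hne,
    Complex.cpow_add _ _ hne]
  ring

lemma integrableOn_powKernel_beta {u v : ℂ} (hu : 0 < u.re) (hv : 0 < v.re) :
    IntegrableOn (powKernel (u - 1) (-(u + v))) (Ioi 0) := by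
  have h := Complex.betaIntegral_convergent hu hv
  rw [intervalIntegrable_iff_integrableOn_Ioo_of_le zero_le_one, ← image_div_one_add_Ioi,
    integrableOn_image_iff_integrableOn_abs_deriv_smul measurableSet_Ioi
      (fun t ht => (hasDerivAt_div_one_add ht).hasDerivWithinAt) injOn_div_one_add_Ioi] at h
  exact h.congr_fun (fun t ht => abs_deriv_smul_beta_integrand u v ht) measurableSet_Ioi

lemma integral_powKernel_beta {u v : ℂ} (hu : 0 < u.re) (hv : 0 < v.re) :
    ∫ t in Ioi (0 : ℝ), powKernel (u - 1) (-(u + v)) t =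
      Complex.Gamma u * Complex.Gamma v / Complex.Gamma (u + v) := by
  rw [Complex.Gamma_mul_Gamma_eq_betaIntegral hu hv, mul_div_cancel_left₀ _
    (Complex.Gamma_ne_zero_of_re_pos (by simp; linarith)), Complex.betaIntegral,
    intervalIntegral.integral_of_le zero_le_one, integral_Ioc_eq_integral_Ioo,
    ← image_div_one_add_Ioi,
    integral_image_eq_integral_abs_deriv_smul measurableSet_Ioi
      (fun t ht => (hasDerivAt_div_one_add ht).hasDerivWithinAt) injOn_div_one_add_Ioi]
  exact setIntegral_congr_fun measurableSet_Ioi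
    fun t ht => (abs_deriv_smul_beta_integrand u v ht).symm

lemma integrableOn_powKernel {p q : ℂ} (hp : -1 < p.re) (hpq : p.re + q.re < -1) :
    IntegrableOn (powKernel p q) (Ioi 0) := by
  have := integrableOn_powKernel_beta (u := p + 1) (v := -(p + q + 1)) (by simp; linarith)
    (by simp; linarith)
  convert this using 2 <;> ring

lemma integral_powKernel {p q : ℂ} (hp : -1 < p.re) (hpq : p.re + q.re < -1) :
    ∫ t in Ioi (0 : ℝ), powKernel p q t =
      Complex.Gamma (p + 1) * Complex.Gamma (-(p + q + 1)) / Complex.Gamma (-q) := by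
  have := integral_powKernel_beta (u := p + 1) (v := -(p + q + 1)) (by simp; linarith)
    (by simp; linarith)
  convert this using 3 <;> ring_nf

/-! ### The Stieltjes transform: bounds and integrability. -/

/-- The Stieltjes transform of the kernel `t ^ p * (1 + t) ^ q` on the positive half-line. -/
noncomputable def stieltjesPow (p q μ : ℂ) : ℂ :=
  ∫ t in Ioi (0 : ℝ), powKernel p q t / ((t : ℂ) + μ)

lemma add_re_le_norm_add (t : ℝ) (μ : ℂ) : t + μ.re ≤ ‖(t : ℂ) + μ‖ := by
  simpa using Complex.re_le_norm ((t : ℂ) + μ)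

lemma ofReal_add_ne_zero {t : ℝ} {μ : ℂ} (ht : 0 < t) (hμ : 0 ≤ μ.re) : (t : ℂ) + μ ≠ 0 := by
  intro h
  have := congrArg Complex.re h
  simp at this
  linarith

lemma norm_powKernel_div_add_le (p q : ℂ) {t : ℝ} {μ : ℂ} {m : ℝ} (ht : 0 < t) (hm : 0 ≤ m)
    (hμ : m ≤ μ.re) : ‖powKernel p q t / ((t : ℂ) + μ)‖ ≤ ‖powKernel p q t‖ / (t + m) := by
  rw [norm_div]
  have := add_re_le_norm_add t μ
  gcongr
  linarith

lemma norm_powKernel_div_add_sq_le (p q : ℂ) {t : ℝ} {μ : ℂ} {m : ℝ} (ht : 0 < t) (hm : 0 < m)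
    (hμ : m ≤ μ.re) : ‖powKernel p q t / ((t : ℂ) + μ) ^ 2‖ ≤ ‖powKernel p q t‖ / (t + m) / m := by
  rw [norm_div, norm_pow, div_div]
  have := add_re_le_norm_add t μ
  gcongr
  nlinarith

lemma continuousOn_powKernel_div_add_pow (p q : ℂ) {μ : ℂ} (hμ : 0 ≤ μ.re) (n : ℕ) :
    ContinuousOn (fun t : ℝ => powKernel p q t / ((t : ℂ) + μ) ^ n) (Ioi 0) := by
  refine (continuousOn_powKernel p q).div (by fun_prop) fun t ht => ?_
  exact pow_ne_zero _ (ofReal_add_ne_zero ht hμ)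

lemma aestronglyMeasurable_powKernel_div_add_pow (p q : ℂ) {μ : ℂ} (hμ : 0 ≤ μ.re) (n : ℕ) :
    AEStronglyMeasurable (fun t : ℝ => powKernel p q t / ((t : ℂ) + μ) ^ n)
      (volume.restrict (Ioi 0)) :=
  (continuousOn_powKernel_div_add_pow p q hμ n).aestronglyMeasurable measurableSet_Ioi

lemma aestronglyMeasurable_powKernel_div_add (p q : ℂ) {μ : ℂ} (hμ : 0 ≤ μ.re) :
    AEStronglyMeasurable (fun t : ℝ => powKernel p q t / ((t : ℂ) + μ))
      (volume.restrict (Ioi 0)) := by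
  simpa using aestronglyMeasurable_powKernel_div_add_pow p q hμ 1

lemma aestronglyMeasurable_norm_powKernel_div_add (p q : ℂ) {m : ℝ} (hm : 0 ≤ m) :
    AEStronglyMeasurable (fun t : ℝ => ‖powKernel p q t‖ / (t + m)) (volume.restrict (Ioi 0)) := by
  refine ContinuousOn.aestronglyMeasurable ?_ measurableSet_Ioi
  refine (continuousOn_powKernel p q).norm.div (by fun_prop) fun t ht => ?_
  have : (0 : ℝ) < t := ht
  positivity

/-- Comparison with `powKernel p (q - 1)`: the ratio (1+t)/(t+m) is at most 1 + 1/m. -/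
lemma integrableOn_norm_powKernel_div_add {p q : ℂ} (hp : -1 < p.re) (hpq : p.re + q.re < 0)
    {m : ℝ} (hm : 0 < m) : IntegrableOn (fun t : ℝ => ‖powKernel p q t‖ / (t + m)) (Ioi 0) := by
  have h : IntegrableOn (powKernel p (q - 1)) (Ioi 0) :=
    integrableOn_powKernel hp (by simp; linarith)
  refine (h.norm.const_mul (1 + 1 / m)).mono'
    (aestronglyMeasurable_norm_powKernel_div_add p q hm.le) ?_
  refine (ae_restrict_iff' measurableSet_Ioi).2 (.of_forall fun t ht => ?_)
  have ht' : (0 : ℝ) < t := ht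
  have h1 := one_add_mul_powKernel p (q - 1) ht
  rw [sub_add_cancel] at h1
  have h2 : ‖(1 + (t : ℂ))‖ = 1 + t := by
    have := Complex.norm_of_nonneg (show 0 ≤ 1 + t by positivity)
    push_cast at this
    exact this
  rw [← h1, norm_mul, h2, Real.norm_of_nonneg (by positivity), div_le_iff₀ (by positivity)]
  have h3 : 1 + t ≤ (1 + 1 / m) * (t + m) := by
    have : (1 + 1 / m) * (t + m) = 1 + t + m + t / m := by field_simp; ring
    rw [this]
    have : 0 ≤ t / m := by positivity
    linarith
  nlinarith [norm_nonneg (powKernel p (q - 1) t)]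

/-- The case Re μ = 0: the factor 1/t lowers the exponent p by one, so integrability at 0 needs Re p
> 0, that is, Re a > 1. -/
lemma integrableOn_norm_powKernel_div {p q : ℂ} (hp : 0 < p.re) (hpq : p.re + q.re < 0) :
    IntegrableOn (fun t : ℝ => ‖powKernel p q t‖ / (t + 0)) (Ioi 0) := by
  have h : IntegrableOn (powKernel (p - 1) q) (Ioi 0) :=
    integrableOn_powKernel (by simp; linarith) (by simp; linarith)
  refine IntegrableOn.congr_fun h.norm (fun t ht => ?_) measurableSet_Ioi
  have ht' : (0 : ℝ) < t := ht
  have h1 := mul_powKernel (p - 1) q ht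
  rw [sub_add_cancel] at h1
  rw [← h1, norm_mul, Complex.norm_of_nonneg ht'.le]
  field_simp
  ring

lemma integrableOn_powKernel_div_add {p q μ : ℂ} (hμ : 0 ≤ μ.re)
    (h : IntegrableOn (fun t : ℝ => ‖powKernel p q t‖ / (t + μ.re)) (Ioi 0)) :
    IntegrableOn (fun t : ℝ => powKernel p q t / ((t : ℂ) + μ)) (Ioi 0) :=
  Integrable.mono' h (aestronglyMeasurable_powKernel_div_add p q hμ)
    ((ae_restrict_iff' measurableSet_Ioi).2
      (.of_forall fun _ ht => norm_powKernel_div_add_le p q ht hμ le_rfl))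

/-! ### Reduction of J to the Stieltjes transform by Fubini. -/

/-- For fixed t > 0 the x-integral of the absolute value is ‖`powKernel p q t`‖ / (t + Re μ), which
is the function assumed integrable. -/
lemma integrable_prod_exp_mul_powKernel {p q μ : ℂ} (hμ : 0 ≤ μ.re)
    (h : IntegrableOn (fun t : ℝ => ‖powKernel p q t‖ / (t + μ.re)) (Ioi 0)) :
    Integrable (fun z : ℝ × ℝ => Complex.exp (-(z.2 + μ) * z.1) * powKernel p q z.2)
      ((volume.restrict (Ioi 0)).prod (volume.restrict (Ioi 0))) := by
  have hm : AEStronglyMeasurable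
      (fun z : ℝ × ℝ => Complex.exp (-(z.2 + μ) * z.1) * powKernel p q z.2)
      ((volume.restrict (Ioi 0)).prod (volume.restrict (Ioi 0))) :=
    (by fun_prop : Continuous fun z : ℝ × ℝ =>
      Complex.exp (-(z.2 + μ) * z.1)).aestronglyMeasurable.mul
      (aestronglyMeasurable_powKernel p q).comp_snd
  rw [integrable_prod_iff' hm]
  constructor
  · refine (ae_restrict_iff' measurableSet_Ioi).2 (.of_forall fun t ht => ?_)
    have ht' : (0 : ℝ) < t := ht
    exact (integrableOn_exp_mul_complex_Ioi (a := -(t + μ)) (by simp; linarith) 0).mul_const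
      (powKernel p q t)
  · refine IntegrableOn.congr_fun h (fun t ht => ?_) measurableSet_Ioi
    have ht' : (0 : ℝ) < t := ht
    have h1 : ∀ x : ℝ, ‖Complex.exp (-(t + μ) * x)‖ = Real.exp (-(t + μ.re) * x) := by
      intro x
      rw [Complex.norm_exp]
      simp
    simp_rw [norm_mul, h1]
    rw [integral_mul_const, integral_exp_mul_Ioi (by linarith)]
    rw [mul_zero, Real.exp_zero, neg_div_neg_eq, one_div_mul_eq_div]

lemma integral_exp_mul_tricomi_integrand {p q μ : ℂ} (hμ : 0 ≤ μ.re)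
    (h : IntegrableOn (fun t : ℝ => ‖powKernel p q t‖ / (t + μ.re)) (Ioi 0)) :
    ∫ x in Ioi (0 : ℝ), ∫ t in Ioi (0 : ℝ), Complex.exp (-(t + μ) * x) * powKernel p q t =
      stieltjesPow p q μ := by
  rw [integral_integral_swap (integrable_prod_exp_mul_powKernel hμ h)]
  refine setIntegral_congr_fun measurableSet_Ioi fun t ht => ?_
  have ht' : (0 : ℝ) < t := ht
  rw [integral_mul_const, integral_exp_mul_complex_Ioi (by simp; linarith)]
  rw [Complex.ofReal_zero, mul_zero, Complex.exp_zero, neg_div_neg_eq, one_div_mul_eq_div]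

lemma exp_mul_tricomiU (a b μ : ℂ) (x : ℝ) :
    Complex.exp (-(μ * (x : ℂ))) * tricomiU a b x = 1 / Complex.Gamma a *
      ∫ t in Ioi (0 : ℝ), Complex.exp (-(t + μ) * x) * powKernel (a - 1) (b - a - 1) t := by
  rw [tricomiU, mul_left_comm, ← integral_const_mul]
  congr 2
  ext t
  rw [powKernel, show -((t : ℂ) + μ) * x = -(μ * x) + -(x * t) by ring, Complex.exp_add]
  ring

theorem tricomiJConverges_of_integrableOn {a b μ : ℂ} (hμ : 0 ≤ μ.re)
    (h : IntegrableOn (fun t : ℝ => ‖powKernel (a - 1) (b - a - 1) t‖ / (t + μ.re)) (Ioi 0)) :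
    TricomiJConverges a b μ := by
  rw [TricomiJConverges]
  simp_rw [exp_mul_tricomiU]
  exact (integrable_prod_exp_mul_powKernel hμ h).integral_prod_left.const_mul _

theorem tricomiJ_eq_stieltjesPow {a b μ : ℂ} (hμ : 0 ≤ μ.re)
    (h : IntegrableOn (fun t : ℝ => ‖powKernel (a - 1) (b - a - 1) t‖ / (t + μ.re)) (Ioi 0)) :
    tricomiJ a b μ = 1 / Complex.Gamma a * stieltjesPow (a - 1) (b - a - 1) μ := by
  rw [tricomiJ]
  simp_rw [exp_mul_tricomiU]
  rw [integral_const_mul, integral_exp_mul_tricomi_integrand hμ h]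

lemma stieltjesPow_one {p q : ℂ} (hp : -1 < p.re) (hpq : p.re + q.re < 0) :
    stieltjesPow p q 1 =
      Complex.Gamma (p + 1) * Complex.Gamma (-(p + q)) / Complex.Gamma (1 - q) := by
  have := integral_powKernel (p := p) (q := q - 1) hp (by simp; linarith)
  rw [show -(p + (q - 1) + 1) = -(p + q) by ring, show -(q - 1) = 1 - q by ring] at this
  rw [← this]
  refine setIntegral_congr_fun measurableSet_Ioi fun t ht => ?_
  have h1 := one_add_mul_powKernel p (q - 1) ht
  rw [sub_add_cancel] at h1
  rw [← h1, add_comm (t : ℂ), mul_div_cancel_left₀ _ (one_add_ofReal_ne_zero ht)]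

/-! ### The differential equation of the Stieltjes transform. -/

lemma integrableOn_powKernel_div_add_sq {p q μ : ℂ} (hp : -1 < p.re) (hpq : p.re + q.re < 0)
    (hμ : 0 < μ.re) :
    IntegrableOn (fun t : ℝ => powKernel p q t / ((t : ℂ) + μ) ^ 2) (Ioi 0) :=
  Integrable.mono' ((integrableOn_norm_powKernel_div_add hp hpq hμ).div_const μ.re)
    (aestronglyMeasurable_powKernel_div_add_pow p q hμ.le 2)
    ((ae_restrict_iff' measurableSet_Ioi).2
      (.of_forall fun _ ht => norm_powKernel_div_add_sq_le p q ht hμ le_rfl))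

lemma hasDerivAt_stieltjesPow {p q μ : ℂ} (hp : -1 < p.re) (hpq : p.re + q.re < 0)
    (hμ : 0 < μ.re) :
    HasDerivAt (stieltjesPow p q)
      (-∫ t in Ioi (0 : ℝ), powKernel p q t / ((t : ℂ) + μ) ^ 2) μ := by
  have hm : 0 < μ.re / 2 := by positivity
  -- On this neighbourhood t + Re z stays above t + Re μ / 2, which gives a bound independent of z.
  have hs : {z : ℂ | μ.re / 2 < z.re} ∈ 𝓝 μ :=
    (isOpen_lt continuous_const Complex.continuous_re).mem_nhds (by
      simp only [mem_ofPred_eq]; linarith)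
  have h := hasDerivAt_integral_of_dominated_loc_of_deriv_le
    (μ := volume.restrict (Ioi (0 : ℝ)))
    (F := fun z t => powKernel p q t / ((t : ℂ) + z))
    (F' := fun z t => -(powKernel p q t / ((t : ℂ) + z) ^ 2))
    (bound := fun t => ‖powKernel p q t‖ / (t + μ.re / 2) / (μ.re / 2)) hs ?_
    (integrableOn_powKernel_div_add hμ.le (integrableOn_norm_powKernel_div_add hp hpq hμ))
    (aestronglyMeasurable_powKernel_div_add_pow p q hμ.le 2).neg ?_
    ((integrableOn_norm_powKernel_div_add hp hpq hm).div_const _) ?_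
  · rw [← integral_neg]
    exact h.2
  · filter_upwards [hs] with z hz
    exact aestronglyMeasurable_powKernel_div_add p q (hm.trans hz).le
  · refine (ae_restrict_iff' measurableSet_Ioi).2 (.of_forall fun t ht z hz => ?_)
    rw [norm_neg]
    exact norm_powKernel_div_add_sq_le p q ht hm (le_of_lt hz)
  · refine (ae_restrict_iff' measurableSet_Ioi).2 (.of_forall fun t ht z hz => ?_)
    have h1 := ((hasDerivAt_id z).const_add (t : ℂ)).fun_inv
      (ofReal_add_ne_zero ht (hm.trans hz).le)
    have h2 := h1.const_mul (powKernel p q t)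
    refine h2.congr_deriv ?_
    simp only [id]
    ring

lemma tendsto_norm_powKernel_atTop {p q : ℂ} (hpq : p.re + q.re < 0) :
    Tendsto (fun t => ‖powKernel p q t‖) atTop (𝓝 0) := by
  have h1 : Tendsto (fun t : ℝ => 1 + t) atTop atTop := tendsto_atTop_add_const_left _ _ tendsto_id
  have h2 : Tendsto (fun t : ℝ => (1 + t) ^ (p.re + q.re)) atTop (𝓝 0) := by
    have := (tendsto_rpow_neg_atTop (y := -(p.re + q.re)) (by linarith)).comp h1
    simpa [Function.comp_def] using this
  have h3 : Tendsto (fun t : ℝ => t / (1 + t)) atTop (𝓝 1) := by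
    have : Tendsto (fun t : ℝ => 1 - (1 + t)⁻¹) atTop (𝓝 (1 - 0)) :=
      tendsto_const_nhds.sub (tendsto_inv_atTop_zero.comp h1)
    rw [sub_zero] at this
    refine this.congr' ?_
    filter_upwards [eventually_gt_atTop 0] with t ht
    field_simp
    ring
  have h4 := (h3.rpow_const (p := p.re) (Or.inl one_ne_zero)).mul h2
  rw [mul_zero] at h4
  refine h4.congr' ?_
  filter_upwards [eventually_gt_atTop 0] with t ht
  have h0 : 0 < 1 + t := by positivity
  rw [norm_powKernel p q ht, Real.div_rpow ht.le h0.le, Real.rpow_add h0]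
  have := (Real.rpow_pos_of_pos h0 p.re).ne'
  field_simp

lemma tendsto_powKernel_div_add_atTop {p q μ : ℂ} (hpq : p.re + q.re < 0) (hμ : 0 ≤ μ.re) :
    Tendsto (fun t : ℝ => powKernel (p + 1) q t / ((t : ℂ) + μ)) atTop (𝓝 0) := by
  refine squeeze_zero_norm' ?_ (tendsto_norm_powKernel_atTop hpq)
  filter_upwards [eventually_gt_atTop 0] with t ht
  refine (norm_powKernel_div_add_le _ _ ht le_rfl hμ).trans ?_
  rw [← mul_powKernel p q ht, norm_mul, Complex.norm_of_nonneg ht.le, add_zero]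
  apply le_of_eq
  field_simp

lemma continuousWithinAt_powKernel_div_add_zero {p q μ : ℂ} (hp : 0 < p.re) (hμ : 0 < μ.re) :
    ContinuousWithinAt (fun t : ℝ => powKernel p q t / ((t : ℂ) + μ)) (Ici 0) 0 := by
  apply ContinuousAt.continuousWithinAt
  have h1 := Complex.continuousAt_ofReal_cpow_const 0 p (Or.inl hp)
  have h2 : ContinuousAt (fun t : ℝ => (1 + (t : ℂ)) ^ q) 0 :=
    (by fun_prop : ContinuousAt (fun t : ℝ => 1 + (t : ℂ)) 0).cpow continuousAt_const (by simp)
  refine (h1.mul h2).div (by fun_prop) ?_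
  intro h
  rw [Complex.ofReal_zero, zero_add] at h
  simp [h] at hμ

/-- The primitive behind the differential equation: its derivative splits into the integrands of S,
of a beta integral and of -S'. -/
lemma hasDerivAt_powKernel_div_add {p q μ : ℂ} (hμ : 0 < μ.re) {t : ℝ} (ht : 0 < t) :
    HasDerivAt (fun t : ℝ => (1 - μ) * (powKernel (p + 1) q t / ((t : ℂ) + μ)))
      ((p - (p + q) * μ) * (powKernel p q t / ((t : ℂ) + μ)) + q * powKernel p (q - 1) t +
        μ * (1 - μ) * (powKernel p q t / ((t : ℂ) + μ) ^ 2)) t := by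
  have hne := ofReal_add_ne_zero ht hμ.le
  have h1 : HasDerivAt (fun t : ℝ => (t : ℂ) + μ) 1 t :=
    (hasDerivAt_id t).ofReal_comp.add_const μ
  refine (((hasDerivAt_powKernel (p + 1) q ht).div h1 hne).const_mul (1 - μ)).congr_deriv ?_
  have e1 := mul_powKernel p (q - 1) ht
  have e2 := mul_powKernel p q ht
  have e3 := one_add_mul_powKernel p (q - 1) ht
  rw [sub_add_cancel] at e3
  rw [add_sub_cancel_right, ← e1, ← e2, ← e3]
  field_simp
  ring

theorem stieltjesPow_deriv_eq {p q μ : ℂ} (hp : -1 < p.re) (hpq : p.re + q.re < 0)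
    (hμ : 0 < μ.re) :
    μ * (1 - μ) * (-∫ t in Ioi (0 : ℝ), powKernel p q t / ((t : ℂ) + μ) ^ 2) =
      (p - (p + q) * μ) * stieltjesPow p q μ -
        Complex.Gamma (p + 1) * Complex.Gamma (-(p + q)) / Complex.Gamma (-q) := by
  have i1 := (integrableOn_powKernel_div_add hμ.le
    (integrableOn_norm_powKernel_div_add hp hpq hμ)).const_mul (p - (p + q) * μ)
  have i2 : IntegrableOn (fun t => q * powKernel p (q - 1) t) (Ioi 0) :=
    (integrableOn_powKernel (p := p) (q := q - 1) hp (by simp; linarith)).const_mul q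
  have i3 := (integrableOn_powKernel_div_add_sq hp hpq hμ).const_mul (μ * (1 - μ))
  have h := integral_Ioi_of_hasDerivAt_of_tendsto
    (f := fun t : ℝ => (1 - μ) * (powKernel (p + 1) q t / ((t : ℂ) + μ)))
    (continuousWithinAt_const.mul
      (continuousWithinAt_powKernel_div_add_zero (by simp; linarith) hμ))
    (fun t ht => hasDerivAt_powKernel_div_add hμ ht) ((i1.add i2).add i3)
    ((tendsto_powKernel_div_add_atTop hpq hμ.le).const_mul (1 - μ))
  have h12 := integral_add (i1.add i2) i3
  have h1 := integral_add i1 i2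
  simp only [Pi.add_apply] at h12 h1
  rw [h12, h1, integral_const_mul, integral_const_mul, integral_const_mul,
    integral_powKernel hp (by simp; linarith)] at h
  have hp1 : p + 1 ≠ 0 := by
    intro h0
    have := congrArg Complex.re h0
    simp at this
    linarith
  have h0 : powKernel (p + 1) q 0 = 0 := by simp [powKernel, Complex.zero_cpow hp1]
  rw [h0, zero_div, mul_zero, sub_zero] at h
  -- This is Γ(1-q) = -q Γ(-q). At q = 0 both sides vanish, because Γ(0) is 0 here and so is
  -- division by it.
  have hG : q * (Complex.Gamma (p + 1) * Complex.Gamma (-(p + (q - 1) + 1)) /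
      Complex.Gamma (-(q - 1))) =
      -(Complex.Gamma (p + 1) * Complex.Gamma (-(p + q)) / Complex.Gamma (-q)) := by
    rw [show -(p + (q - 1) + 1) = -(p + q) by ring, show -(q - 1) = -q + 1 by ring]
    rcases eq_or_ne q 0 with rfl | hq
    · simp [Complex.Gamma_zero]
    · rw [Complex.Gamma_add_one _ (neg_ne_zero.2 hq)]
      field_simp
  rw [hG] at h
  rw [stieltjesPow]
  linear_combination -h

/-! ### The series ₂F₁(1, c; d; μ) and its differential equation. -/

/-- The coefficients `(c)_n / (d)_n` of the hypergeometric series `₂F₁(1, c; d; ·)`. -/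
noncomputable def pochhammerRatio (c d : ℂ) (n : ℕ) : ℂ :=
  (ascPochhammer ℂ n).eval c / (ascPochhammer ℂ n).eval d

lemma pochhammerRatio_zero (c d : ℂ) : pochhammerRatio c d 0 = 1 := by simp [pochhammerRatio]

lemma pochhammerRatio_succ (c d : ℂ) (n : ℕ) :
    pochhammerRatio c d (n + 1) = (c + n) / (d + n) * pochhammerRatio c d n := by
  rw [pochhammerRatio, pochhammerRatio, ascPochhammer_succ_eval, ascPochhammer_succ_eval,
    mul_div_mul_comm, mul_comm]

lemma pochhammerRatio_succ_left (c d : ℂ) (n : ℕ) :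
    pochhammerRatio c d (n + 1) = c / d * pochhammerRatio (c + 1) (d + 1) n := by
  simp [pochhammerRatio, ascPochhammer_succ_left, Polynomial.eval_comp, mul_div_mul_comm]

lemma ordinaryHypergeometricCoefficient_one_left (c d : ℂ) (n : ℕ) :
    ordinaryHypergeometricCoefficient 1 c d n = pochhammerRatio c d n := by
  rw [ordinaryHypergeometricCoefficient, pochhammerRatio, ascPochhammer_eval_one,
    inv_mul_cancel₀ (by exact_mod_cast n.factorial_ne_zero), one_mul, div_eq_mul_inv]

lemma ordinaryHypergeometric_one_left (c d μ : ℂ) :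
    ordinaryHypergeometric 1 c d μ = ∑' n : ℕ, pochhammerRatio c d n * μ ^ n := by
  rw [ordinaryHypergeometric_eq_tsum]
  simp only [smul_eq_mul]
  exact tsum_congr fun n => by rw [← ordinaryHypergeometricCoefficient_one_left]

lemma summable_norm_pochhammerRatio_mul_pow {c d : ℂ} (hc : 0 < c.re)
    (hd : ∀ n : ℕ, d ≠ -(n : ℂ)) {r : ℝ} (h0 : 0 ≤ r) (h1 : r < 1) :
    Summable fun n : ℕ => ‖pochhammerRatio c d n‖ * r ^ n := by
  have hrad : (ordinaryHypergeometricSeries ℂ (1 : ℂ) c d).radius = 1 := by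
    refine ordinaryHypergeometricSeries_radius_eq_one ℂ 1 c d fun n => ⟨?_, ?_, ?_⟩
    · intro h
      have := congrArg Complex.re h
      simp at this
      linarith [(Nat.cast_nonneg n : (0 : ℝ) ≤ n)]
    · intro h
      have := congrArg Complex.re h
      simp at this
      linarith [(Nat.cast_nonneg n : (0 : ℝ) ≤ n)]
    · intro h
      exact hd n (by rw [h, neg_neg])
  have := (ordinaryHypergeometricSeries ℂ (1 : ℂ) c d).summable_norm_mul_pow
    (r := ⟨r, h0⟩) (by rw [hrad]; exact ENNReal.coe_lt_one_iff.2 h1)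
  refine this.congr fun n => ?_
  rw [ordinaryHypergeometricSeries, FormalMultilinearSeries.ofScalars_norm,
    ordinaryHypergeometricCoefficient_one_left]
  rfl

lemma summable_pochhammerRatio_mul_pow {c d : ℂ} (hc : 0 < c.re)
    (hd : ∀ n : ℕ, d ≠ -(n : ℂ)) {μ : ℂ} (hμ : ‖μ‖ < 1) :
    Summable fun n : ℕ => pochhammerRatio c d n * μ ^ n := by
  refine Summable.of_norm ?_
  simpa using summable_norm_pochhammerRatio_mul_pow hc hd (norm_nonneg μ) hμ

/-- The series is dominated on a disc of radius r with ‖μ‖ < r < 1, so it may be differentiated term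
by term. -/
lemma hasSum_deriv_ordinaryHypergeometric {c d : ℂ} (hc : 0 < c.re)
    (hd : ∀ n : ℕ, d ≠ -(n : ℂ)) {μ : ℂ} (hμ : ‖μ‖ < 1) :
    HasSum (fun n : ℕ => pochhammerRatio c d n * (n * μ ^ (n - 1)))
        (deriv (ordinaryHypergeometric 1 c d) μ) ∧
      DifferentiableAt ℂ (ordinaryHypergeometric 1 c d) μ := by
  obtain ⟨r, hr, hr1⟩ := exists_between hμ
  have hr0 : 0 ≤ r := (norm_nonneg μ).trans hr.le
  have hs := summable_norm_pochhammerRatio_mul_pow hc hd hr0 hr1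
  have hd' : ∀ n : ℕ, DifferentiableOn ℂ (fun z : ℂ => pochhammerRatio c d n * z ^ n)
      (Metric.ball 0 r) := fun n => by fun_prop
  have hb : ∀ (n : ℕ) (z : ℂ), z ∈ Metric.ball (0 : ℂ) r →
      ‖pochhammerRatio c d n * z ^ n‖ ≤ ‖pochhammerRatio c d n‖ * r ^ n := by
    intro n z hz
    rw [norm_mul, norm_pow]
    have : ‖z‖ ≤ r := by simpa using (mem_ball_zero_iff.1 hz).le
    gcongr
  have hmem : μ ∈ Metric.ball (0 : ℂ) r := mem_ball_zero_iff.2 hr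
  have heq : ordinaryHypergeometric 1 c d =
      fun z : ℂ => ∑' n : ℕ, pochhammerRatio c d n * z ^ n :=
    funext (ordinaryHypergeometric_one_left c d)
  rw [heq]
  constructor
  · have := Complex.hasSum_deriv_of_summable_norm hs hd' Metric.isOpen_ball hb hmem
    refine this.congr_fun fun n => ?_
    simp
  · exact (Complex.differentiableOn_tsum_of_summable_norm hs hd' Metric.isOpen_ball
      hb).differentiableAt (Metric.isOpen_ball.mem_nhds hmem)

theorem ordinaryHypergeometric_one_left_deriv_eq {c d : ℂ} (hc : 0 < c.re)
    (hd : ∀ n : ℕ, d ≠ -(n : ℂ)) {μ : ℂ} (hμ : ‖μ‖ < 1) :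
    μ * (1 - μ) * deriv (ordinaryHypergeometric 1 c d) μ =
      (1 - d + c * μ) * ordinaryHypergeometric 1 c d μ - (1 - d) := by
  have h1 := (hasSum_deriv_ordinaryHypergeometric hc hd hμ).1
  have h0 := (summable_pochhammerRatio_mul_pow hc hd hμ).hasSum
  rw [← ordinaryHypergeometric_one_left] at h0
  have hA := (h1.mul_left μ).sub (h0.mul_left (1 - d))
  have hB := (h1.mul_left (μ ^ 2)).add (h0.mul_left (c * μ))
  -- Dropping the term n = 0, equal to -(1-d), produces the inhomogeneity. The shifted terms then
  -- match those of `hB` by (d+n) r_(n+1) = (c+n) r_n.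
  rw [← hasSum_nat_add_iff' 1] at hA
  have h2 : ∀ n : ℕ, μ ^ 2 * (pochhammerRatio c d n * (n * μ ^ (n - 1))) +
      c * μ * (pochhammerRatio c d n * μ ^ n) =
      μ * (pochhammerRatio c d (n + 1) * ((n + 1 : ℕ) * μ ^ (n + 1 - 1))) -
        (1 - d) * (pochhammerRatio c d (n + 1) * μ ^ (n + 1)) := by
    intro n
    have hdn : d + n ≠ 0 := fun h => hd n (eq_neg_of_add_eq_zero_left h)
    have hn : (n : ℂ) * μ ^ (n - 1) * μ = n * μ ^ n := by
      cases n with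
      | zero => simp
      | succ k => simp; ring
    rw [pochhammerRatio_succ, Nat.add_sub_cancel]
    have e : (c + n) / (d + n) * pochhammerRatio c d n * (d + n) =
        (c + n) * pochhammerRatio c d n := by field_simp
    push_cast
    linear_combination μ * pochhammerRatio c d n * hn - μ ^ (n + 1) * e
  have h3 := hA.unique (hB.congr_fun fun n => (h2 n).symm)
  simp [pochhammerRatio_zero] at h3
  linear_combination h3

theorem ordinaryHypergeometric_one_left_eq_one_add {c d : ℂ} (hc : 0 < c.re)
    (hd : ∀ n : ℕ, d ≠ -(n : ℂ)) {μ : ℂ} (hμ : ‖μ‖ < 1) :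
    ordinaryHypergeometric 1 c d μ =
      1 + c / d * μ * ordinaryHypergeometric 1 (c + 1) (d + 1) μ := by
  rw [ordinaryHypergeometric_one_left, (summable_pochhammerRatio_mul_pow hc hd hμ).tsum_eq_zero_add,
    ordinaryHypergeometric_one_left, ← tsum_mul_left]
  simp only [pochhammerRatio_zero, pow_zero, mul_one]
  congr 1
  refine tsum_congr fun n => ?_
  rw [pochhammerRatio_succ_left]
  ring

/-! ### Behaviour at 0+. -/

lemma cpow_mul_powKernel_comp_mul (p q : ℂ) {x s : ℝ} (hx : 0 < x) (hs : 0 < s) :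
    (x : ℂ) ^ (1 - p) * x * (powKernel p q (x * s) / (((x * s : ℝ) : ℂ) + x) ^ 2) =
      powKernel p (-2) s * (1 + (x : ℂ) * s) ^ q := by
  have hx0 : (x : ℂ) ≠ 0 := by exact_mod_cast hx.ne'
  have h1 := one_add_ofReal_ne_zero hs
  have h2 : (x : ℂ) ^ (1 - p) * (x : ℂ) ^ p = x := by
    rw [← Complex.cpow_add _ _ hx0, sub_add_cancel, Complex.cpow_one]
  rw [powKernel, powKernel, Complex.cpow_neg, show (2 : ℂ) = ((2 : ℕ) : ℂ) by norm_num,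
    Complex.cpow_natCast, Complex.ofReal_mul, Complex.mul_cpow_ofReal_nonneg hx.le hs.le,
    show (x : ℂ) * s + x = x * (1 + s) by ring]
  field_simp
  linear_combination ((s : ℂ) ^ p * (1 + (x : ℂ) * s) ^ q) * h2

lemma cpow_mul_integral_powKernel_div_add_sq (p q : ℂ) {x : ℝ} (hx : 0 < x) :
    (x : ℂ) ^ (1 - p) * ∫ t in Ioi (0 : ℝ), powKernel p q t / ((t : ℂ) + x) ^ 2 =
      ∫ s in Ioi (0 : ℝ), powKernel p (-2) s * (1 + (x : ℂ) * s) ^ q := by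
  have h := integral_comp_mul_left_Ioi
    (fun t : ℝ => powKernel p q t / ((t : ℂ) + x) ^ 2) 0 hx
  rw [mul_zero, eq_inv_smul_iff₀ hx.ne', Complex.real_smul] at h
  rw [← h, ← mul_assoc, ← integral_const_mul]
  exact setIntegral_congr_fun measurableSet_Ioi
    fun s hs => cpow_mul_powKernel_comp_mul p q hx hs

/-- A bound uniform in x: (1+xs)^(Re q) is at most (1+s)^(Re q) if Re q ≥ 0 and at most 1 if Re q ≤
0; the sum covers both signs. -/
lemma norm_powKernel_mul_one_add_cpow_le (p q : ℂ) {x s : ℝ} (hx : 0 < x) (hx1 : x ≤ 1)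
    (hs : 0 < s) : ‖powKernel p (-2) s * (1 + (x : ℂ) * s) ^ q‖ ≤
      ‖powKernel p (-2) s‖ + ‖powKernel p (-2 + q) s‖ := by
  have hxs : 0 < 1 + x * s := by positivity
  have h1 : ‖(1 + (x : ℂ) * s) ^ q‖ = (1 + x * s) ^ q.re := by
    have := Complex.norm_cpow_eq_rpow_re_of_pos hxs q
    push_cast at this
    exact this
  have h2 : (1 + x * s) ^ q.re ≤ 1 + (1 + s) ^ q.re := by
    rcases le_total 0 q.re with hq | hq
    · have : (1 + x * s) ^ q.re ≤ (1 + s) ^ q.re :=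
        Real.rpow_le_rpow hxs.le (by nlinarith) hq
      linarith
    · have : (1 + x * s) ^ q.re ≤ 1 :=
        Real.rpow_le_one_of_one_le_of_nonpos (by nlinarith) hq
      have : 0 ≤ (1 + s) ^ q.re := by positivity
      linarith
  have hs1 : 0 < 1 + s := by positivity
  rw [norm_mul, h1, norm_powKernel _ _ hs, norm_powKernel _ _ hs, Complex.add_re,
    Real.rpow_add hs1]
  have h3 : 0 ≤ s ^ p.re * (1 + s) ^ (-2 : ℂ).re := by positivity
  calc _ ≤ s ^ p.re * (1 + s) ^ (-2 : ℂ).re * (1 + (1 + s) ^ q.re) := by gcongr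
    _ = _ := by ring

/-- After t = xs, dominated convergence leaves ∫ s^p (1+s)^(-2) ds. The analogous limit integral for
S itself, ∫ s^p / (1+s) ds, needs Re p < 0; the derivative allows Re p < 1, hence Re a < 2. -/
theorem tendsto_cpow_mul_integral_powKernel_div_add_sq {p q : ℂ} (hp : -1 < p.re)
    (hp1 : p.re < 1) (hpq : p.re + q.re < 0) :
    Tendsto (fun x : ℝ => (x : ℂ) ^ (1 - p) *
        ∫ t in Ioi (0 : ℝ), powKernel p q t / ((t : ℂ) + x) ^ 2) (𝓝[>] 0)
      (𝓝 (Complex.Gamma (p + 1) * Complex.Gamma (1 - p))) := by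
  have hI : ∫ s in Ioi (0 : ℝ), powKernel p (-2) s =
      Complex.Gamma (p + 1) * Complex.Gamma (1 - p) := by
    rw [integral_powKernel hp (by simp; linarith), show -(p + -2 + 1) = 1 - p by ring,
      show (- -2 : ℂ) = 1 + 1 by norm_num, Complex.Gamma_add_one _ one_ne_zero, Complex.Gamma_one]
    simp
  rw [← hI]
  have key : Tendsto (fun x : ℝ => ∫ s in Ioi (0 : ℝ), powKernel p (-2) s * (1 + (x : ℂ) * s) ^ q)
      (𝓝[>] 0) (𝓝 (∫ s in Ioi (0 : ℝ), powKernel p (-2) s)) := by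
    refine tendsto_integral_filter_of_dominated_convergence
      (fun s => ‖powKernel p (-2) s‖ + ‖powKernel p (-2 + q) s‖) ?_ ?_ ?_ ?_
    · filter_upwards [self_mem_nhdsWithin] with x hx
      refine (aestronglyMeasurable_powKernel p (-2)).mul ?_
      refine ContinuousOn.aestronglyMeasurable ?_ measurableSet_Ioi
      refine ContinuousOn.cpow_const (by fun_prop) fun s hs => ?_
      rw [← Complex.ofReal_mul]
      exact one_add_ofReal_mem_slitPlane (mul_pos hx hs)
    · filter_upwards [Ioc_mem_nhdsGT zero_lt_one] with x hx
      exact (ae_restrict_iff' measurableSet_Ioi).2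
        (.of_forall fun s hs => norm_powKernel_mul_one_add_cpow_le p q hx.1 hx.2 hs)
    · exact (integrableOn_powKernel hp (by simp; linarith)).norm.add
        (integrableOn_powKernel hp (by simp; linarith)).norm
    · refine .of_forall fun s => ?_
      have h1 : ContinuousAt (fun x : ℝ => (1 + (x : ℂ) * s) ^ q) 0 :=
        (by fun_prop : ContinuousAt (fun x : ℝ => 1 + (x : ℂ) * s) 0).cpow
          continuousAt_const (by simp)
      have h2 := h1.tendsto.mono_left (nhdsWithin_le_nhds (s := Ioi 0))
      simpa using h2.const_mul (powKernel p (-2) s)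
  refine key.congr' ?_
  filter_upwards [self_mem_nhdsWithin] with x hx
  exact (cpow_mul_integral_powKernel_div_add_sq p q hx).symm

lemma tendsto_cpow_mul_deriv_ordinaryHypergeometric {c d : ℂ} (hc : 0 < c.re)
    (hd : ∀ n : ℕ, d ≠ -(n : ℂ)) {s : ℂ} (hs : 0 < s.re) :
    Tendsto (fun x : ℝ => (x : ℂ) ^ s * deriv (ordinaryHypergeometric 1 c d) (x : ℂ)) (𝓝[>] 0)
      (𝓝 0) := by
  have h1 : DifferentiableOn ℂ (ordinaryHypergeometric 1 c d) (Metric.ball (0 : ℂ) 1) :=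
    fun z hz => (hasSum_deriv_ordinaryHypergeometric hc hd
      (mem_ball_zero_iff.1 hz)).2.differentiableWithinAt
  have h2 : ContinuousAt (deriv (ordinaryHypergeometric 1 c d)) ((0 : ℝ) : ℂ) := by
    rw [Complex.ofReal_zero]
    exact ((h1.deriv Metric.isOpen_ball).differentiableAt
      (Metric.ball_mem_nhds 0 one_pos)).continuousAt
  have h3 : ContinuousAt (fun x : ℝ => deriv (ordinaryHypergeometric 1 c d) (x : ℂ)) 0 :=
    h2.comp Complex.continuous_ofReal.continuousAt
  have h4 := (Complex.continuousAt_ofReal_cpow_const 0 s (Or.inl hs)).mul h3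
  have h5 : Tendsto (fun x : ℝ => (x : ℂ) ^ s * deriv (ordinaryHypergeometric 1 c d) (x : ℂ))
      (𝓝[>] 0) (𝓝 (((0 : ℝ) : ℂ) ^ s * deriv (ordinaryHypergeometric 1 c d) ((0 : ℝ) : ℂ))) :=
    h4.tendsto.mono_left nhdsWithin_le_nhds
  have hs0 : s ≠ 0 := by
    rintro rfl
    simp at hs
  simpa [Complex.zero_cpow hs0] using h5

/-! ### Identification on the right half disc. -/

/-- The open right half of the unit disc. -/
def rightHalfDisc : Set ℂ := {z | 0 < z.re} ∩ Metric.ball 0 1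

lemma isOpen_rightHalfDisc : IsOpen rightHalfDisc :=
  (isOpen_lt continuous_const Complex.continuous_re).inter Metric.isOpen_ball

lemma isPreconnected_rightHalfDisc : IsPreconnected rightHalfDisc :=
  ((convex_halfSpace_re_gt 0).inter (convex_ball 0 1)).isPreconnected

lemma one_sub_mem_slitPlane {z : ℂ} (hz : ‖z‖ < 1) : 1 - z ∈ Complex.slitPlane := by
  left
  have := (Complex.re_le_norm z).trans_lt hz
  simp
  linarith

/-- The solutions of `z (1 - z) y' = (a - 1 + c z) y` on the right half of the unit disc are the
multiples of `z ^ (a - 1) * (1 - z) ^ (1 - a - c)`. -/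
lemma exists_const_of_hasDerivAt {a c : ℂ} {G G' : ℂ → ℂ}
    (hG : ∀ z ∈ rightHalfDisc, HasDerivAt G (G' z) z)
    (hode : ∀ z ∈ rightHalfDisc, z * (1 - z) * G' z = (a - 1 + c * z) * G z) :
    ∃ K : ℂ, ∀ z ∈ rightHalfDisc, z ^ (1 - a) * (1 - z) ^ (a + c - 1) * G z = K := by
  -- The integrating factor comes from (a-1+cz) / (z(1-z)) = (a-1)/z + (a+c-1)/(1-z).
  have hder : ∀ z ∈ rightHalfDisc,
      HasDerivAt (fun z => z ^ (1 - a) * (1 - z) ^ (a + c - 1) * G z) 0 z := by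
    intro z hz
    have hz0 : z ∈ Complex.slitPlane := Or.inl hz.1
    have hz1 := one_sub_mem_slitPlane (mem_ball_zero_iff.1 hz.2)
    have d1 := (hasDerivAt_id z).cpow_const (c := 1 - a) hz0
    have d2 := ((hasDerivAt_id z).const_sub 1).cpow_const (c := a + c - 1) hz1
    refine ((d1.mul d2).mul (hG z hz)).congr_deriv ?_
    have n0 := Complex.slitPlane_ne_zero hz0
    have n1 := Complex.slitPlane_ne_zero hz1
    simp only [id, Pi.mul_apply]
    rw [Complex.cpow_sub (1 - a) 1 n0, Complex.cpow_sub (a + c - 1) 1 n1, Complex.cpow_one,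
      Complex.cpow_one]
    have := hode z hz
    field_simp
    linear_combination (z ^ (1 - a) * (1 - z) ^ (a + c - 1)) * this
  exact isOpen_rightHalfDisc.exists_is_const_of_deriv_eq_zero isPreconnected_rightHalfDisc
    (fun z hz => (hder z hz).differentiableAt.differentiableWithinAt)
    (fun z hz => (hder z hz).deriv)

/-- The value of `stieltjesPow (a - 1) (1 - a - c) μ / Γ(a)` for `‖μ‖ < 1`. -/
noncomputable def stieltjesClosedForm (a c μ : ℂ) : ℂ :=
  Complex.Gamma c / ((a - 1) * Complex.Gamma (a + c - 1)) *
      ordinaryHypergeometric 1 c (2 - a) μ +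
    μ ^ (a - 1) * Complex.Gamma (1 - a) / (1 - μ) ^ (a + c - 1)

lemma two_sub_ne_neg_natCast {a : ℂ} (ha : ∀ n : ℕ, a ≠ (n : ℂ) + 1) (n : ℕ) :
    2 - a ≠ -(n : ℂ) := by
  intro h
  apply ha (n + 1)
  push_cast
  linear_combination -h

theorem stieltjesPow_eq_of_re_lt_two {a c μ : ℂ} (ha : 0 < a.re) (ha2 : a.re < 2)
    (hc : 0 < c.re) (hn : ∀ n : ℕ, a ≠ (n : ℂ) + 1) (hμ : 0 < μ.re) (hμ1 : ‖μ‖ < 1) :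
    stieltjesPow (a - 1) (1 - a - c) μ = Complex.Gamma a * stieltjesClosedForm a c μ := by
  have hd := two_sub_ne_neg_natCast hn
  have ha1 : a - 1 ≠ 0 := sub_ne_zero.2 (by simpa using hn 0)
  have hp : -1 < (a - 1).re := by simp; linarith
  have hpq : (a - 1).re + (1 - a - c).re < 0 := by simp; linarith
  -- E is chosen so that E · ₂F₁ has the same inhomogeneous term as S.
  obtain ⟨E, hE⟩ : ∃ E, E = Complex.Gamma a * Complex.Gamma c /
      ((a - 1) * Complex.Gamma (a + c - 1)) := ⟨_, rfl⟩
  have hEa : E * (a - 1) = Complex.Gamma a * Complex.Gamma c / Complex.Gamma (a + c - 1) := by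
    rw [hE, div_mul_eq_mul_div, mul_comm (a - 1), mul_div_mul_right _ _ ha1]
  obtain ⟨F', hF'⟩ : ∃ F' : ℂ → ℂ, ∀ z, F' z =
      -∫ t in Ioi (0 : ℝ), powKernel (a - 1) (1 - a - c) t / ((t : ℂ) + z) ^ 2 :=
    ⟨_, fun _ => rfl⟩
  have hFode : ∀ z : ℂ, 0 < z.re → z * (1 - z) * F' z =
      (a - 1 + c * z) * stieltjesPow (a - 1) (1 - a - c) z - E * (a - 1) := by
    intro z hz
    have := stieltjesPow_deriv_eq hp hpq hz
    rw [← hF'] at this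
    rw [show a - 1 + 1 = a by ring, show a - 1 + (1 - a - c) = -c by ring, neg_neg,
      show -(1 - a - c) = a + c - 1 by ring] at this
    rw [hEa, this]
    ring
  have hfode : ∀ z : ℂ, ‖z‖ < 1 → z * (1 - z) * deriv (ordinaryHypergeometric 1 c (2 - a)) z =
      (a - 1 + c * z) * ordinaryHypergeometric 1 c (2 - a) z - (a - 1) := by
    intro z hz
    rw [ordinaryHypergeometric_one_left_deriv_eq hc hd hz]
    ring
  have hode : ∀ z ∈ rightHalfDisc,
      z * (1 - z) * (F' z - E * deriv (ordinaryHypergeometric 1 c (2 - a)) z) =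
      (a - 1 + c * z) * (stieltjesPow (a - 1) (1 - a - c) z -
        E * ordinaryHypergeometric 1 c (2 - a) z) := by
    intro z hz
    linear_combination hFode z hz.1 - E * hfode z (mem_ball_zero_iff.1 hz.2)
  obtain ⟨K, hK⟩ := exists_const_of_hasDerivAt
    (G := fun z => stieltjesPow (a - 1) (1 - a - c) z -
      E * ordinaryHypergeometric 1 c (2 - a) z)
    (fun z hz => (hF' z ▸ hasDerivAt_stieltjesPow hp hpq hz.1).sub
      ((hasSum_deriv_ordinaryHypergeometric hc hd
        (mem_ball_zero_iff.1 hz.2)).2.hasDerivAt.const_mul E)) hode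
  have hlim1 : Tendsto (fun x : ℝ => (1 - (x : ℂ)) * (1 - (x : ℂ)) ^ (a + c - 1) *
      ((x : ℂ) ^ (2 - a) * F' (x : ℂ) -
        E * ((x : ℂ) ^ (2 - a) * deriv (ordinaryHypergeometric 1 c (2 - a)) (x : ℂ))))
      (𝓝[>] 0) (𝓝 (-(Complex.Gamma a * Complex.Gamma (2 - a)))) := by
    have l1 := tendsto_cpow_mul_integral_powKernel_div_add_sq hp (by simp; linarith) hpq
    rw [show 1 - (a - 1) = 2 - a by ring, sub_add_cancel] at l1
    have l2 := tendsto_cpow_mul_deriv_ordinaryHypergeometric hc hd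
      (s := 2 - a) (by simp; linarith)
    have l3 : ContinuousAt (fun x : ℝ => (1 - (x : ℂ)) * (1 - (x : ℂ)) ^ (a + c - 1)) 0 :=
      ContinuousAt.mul (by fun_prop) ((by fun_prop : ContinuousAt (fun x : ℝ => 1 - (x : ℂ)) 0).cpow
        continuousAt_const (by simp))
    have l4 := l3.tendsto.mono_left (nhdsWithin_le_nhds (s := Ioi 0))
    have l5 := l4.mul (l1.neg.sub (l2.const_mul E))
    have e : (1 - ((0 : ℝ) : ℂ)) * (1 - ((0 : ℝ) : ℂ)) ^ (a + c - 1) *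
        (-(Complex.Gamma a * Complex.Gamma (2 - a)) - E * 0) =
        -(Complex.Gamma a * Complex.Gamma (2 - a)) := by simp
    rw [e] at l5
    refine l5.congr fun x => ?_
    rw [hF', mul_neg]
  have hlim2 : Tendsto (fun x : ℝ => (a - 1 + c * (x : ℂ)) * K) (𝓝[>] 0) (𝓝 ((a - 1) * K)) := by
    have l1 : ContinuousAt (fun x : ℝ => (a - 1 + c * (x : ℂ)) * K) 0 := by fun_prop
    simpa using l1.tendsto.mono_left (nhdsWithin_le_nhds (s := Ioi 0))
  -- The homogeneous equation times the integrating factor equates the expressions in `hlim1` and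
  -- `hlim2` on (0, 1); their limits at 0+ determine K.
  have hKval : (a - 1) * K = -(Complex.Gamma a * Complex.Gamma (2 - a)) := by
    refine tendsto_nhds_unique hlim2 (hlim1.congr' ?_)
    filter_upwards [Ioo_mem_nhdsGT zero_lt_one] with x hx
    have hmem : (x : ℂ) ∈ rightHalfDisc := by
      refine ⟨by simpa using hx.1, ?_⟩
      rw [mem_ball_zero_iff, Complex.norm_of_nonneg hx.1.le]
      exact hx.2
    have hx0 : (x : ℂ) ≠ 0 := by exact_mod_cast hx.1.ne'
    have e1 := hode x hmem
    have e2 := hK x hmem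
    have e3 : (x : ℂ) ^ (2 - a) = x * (x : ℂ) ^ (1 - a) := by
      rw [show 2 - a = 1 + (1 - a) by ring, Complex.cpow_add _ _ hx0, Complex.cpow_one]
    rw [← e2, e3]
    linear_combination ((x : ℂ) ^ (1 - a) * (1 - (x : ℂ)) ^ (a + c - 1)) * e1
  have hK' : K = Complex.Gamma a * Complex.Gamma (1 - a) := by
    apply mul_left_cancel₀ ha1
    rw [hKval, show 2 - a = 1 - a + 1 by ring,
      Complex.Gamma_add_one _ (by rw [← neg_sub]; exact neg_ne_zero.2 ha1)]
    ring
  have hfin := hK μ ⟨hμ, mem_ball_zero_iff.2 hμ1⟩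
  have hμ0 : μ ≠ 0 := Complex.slitPlane_ne_zero (Or.inl hμ)
  have h1 : (1 - μ) ^ (a + c - 1) ≠ 0 := fun h =>
    Complex.slitPlane_ne_zero (one_sub_mem_slitPlane hμ1) ((Complex.cpow_eq_zero_iff _ _).1 h).1
  have h2 : μ ^ (1 - a) * μ ^ (a - 1) = 1 := by
    rw [← Complex.cpow_add _ _ hμ0]
    simp
  have h3 : stieltjesPow (a - 1) (1 - a - c) μ - E * ordinaryHypergeometric 1 c (2 - a) μ =
      Complex.Gamma a * (μ ^ (a - 1) * Complex.Gamma (1 - a) / (1 - μ) ^ (a + c - 1)) := by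
    field_simp
    rw [hK'] at hfin
    linear_combination μ ^ (a - 1) * hfin - ((1 - μ) ^ (a + c - 1) *
      (stieltjesPow (a - 1) (1 - a - c) μ - E * ordinaryHypergeometric 1 c (2 - a) μ)) * h2
  rw [stieltjesClosedForm, mul_add, ← h3, hE]
  ring

/-! ### Contiguous relations, all Re a > 0, and the line Re μ = 0. -/

/-- Write t/(t+μ) = 1 - μ/(t+μ); the first part is a beta integral. -/
lemma stieltjesPow_eq_sub {p q μ : ℂ} (hp : 0 < p.re) (hpq : p.re + q.re < 0) (hμ : 0 < μ.re) :
    stieltjesPow p q μ = Complex.Gamma p * Complex.Gamma (-(p + q)) / Complex.Gamma (-q) -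
      μ * stieltjesPow (p - 1) q μ := by
  have hp1 : -1 < (p - 1).re := by simp; linarith
  have hI := integral_powKernel (p := p - 1) (q := q) hp1 (by simp; linarith)
  rw [show -(p - 1 + q + 1) = -(p + q) by ring, sub_add_cancel] at hI
  rw [← hI, stieltjesPow, stieltjesPow, ← integral_const_mul, ← integral_sub]
  · refine setIntegral_congr_fun measurableSet_Ioi fun t ht => ?_
    have h1 := mul_powKernel (p - 1) q ht
    rw [sub_add_cancel] at h1
    have := ofReal_add_ne_zero ht hμ.le
    rw [← h1]
    field_simp
    ring
  · exact integrableOn_powKernel hp1 (by simp; linarith)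
  · exact (integrableOn_powKernel_div_add hμ.le
      (integrableOn_norm_powKernel_div_add hp1 (by simp; linarith) hμ)).const_mul μ

/-- The closed form obeys the recurrence of `stieltjesPow_eq_sub`: the constant term of ₂F₁ supplies
the beta value, and a + c - 1 is replaced by itself. -/
lemma stieltjesClosedForm_eq_sub {a c μ : ℂ} (ha : 1 < a.re) (hc : 0 < c.re)
    (hn : ∀ n : ℕ, a ≠ (n : ℂ) + 1) (hμ0 : μ ≠ 0) (hμ : ‖μ‖ < 1) :
    Complex.Gamma a * stieltjesClosedForm a c μ =
      Complex.Gamma (a - 1) * Complex.Gamma c / Complex.Gamma (a + c - 1) -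
        μ * (Complex.Gamma (a - 1) * stieltjesClosedForm (a - 1) (c + 1) μ) := by
  have ha1 : a - 1 ≠ 0 := sub_ne_zero.2 (by simpa using hn 0)
  have ha2 : a - 2 ≠ 0 := by
    have := hn 1
    rw [Nat.cast_one, one_add_one_eq_two] at this
    exact sub_ne_zero.2 this
  have hda : 2 - a ≠ 0 := by rw [← neg_sub]; exact neg_ne_zero.2 ha2
  have hc0 : c ≠ 0 := by rintro rfl; simp at hc
  have hG : Complex.Gamma (a + c - 1) ≠ 0 :=
    Complex.Gamma_ne_zero_of_re_pos (by simp; linarith)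
  have h1 : (1 - μ) ^ (a + c - 1) ≠ 0 := fun h =>
    Complex.slitPlane_ne_zero (one_sub_mem_slitPlane hμ) ((Complex.cpow_eq_zero_iff _ _).1 h).1
  have g1 : Complex.Gamma a = (a - 1) * Complex.Gamma (a - 1) := by
    simpa using Complex.Gamma_add_one (a - 1) ha1
  have g2 : Complex.Gamma (1 - (a - 1)) = (1 - a) * Complex.Gamma (1 - a) := by
    rw [← Complex.Gamma_add_one _ (by rw [← neg_sub]; exact neg_ne_zero.2 ha1)]
    congr 1
    ring
  have g3 : μ ^ (a - 1) = μ * μ ^ (a - 1 - 1) := by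
    rw [Complex.cpow_sub (a - 1) 1 hμ0, Complex.cpow_one]
    field_simp
  rw [stieltjesClosedForm, stieltjesClosedForm,
    ordinaryHypergeometric_one_left_eq_one_add hc (two_sub_ne_neg_natCast hn) hμ, g1, g2, g3,
    Complex.Gamma_add_one c hc0, show a - 1 + (c + 1) - 1 = a + c - 1 by ring,
    show 2 - (a - 1) = 2 - a + 1 by ring, show a - 1 - 1 = a - 2 by ring]
  field_simp
  ring

theorem stieltjesPow_eq {a c μ : ℂ} (ha : 0 < a.re) (hc : 0 < c.re)
    (hn : ∀ n : ℕ, a ≠ (n : ℂ) + 1) (hμ : 0 < μ.re) (hμ1 : ‖μ‖ < 1) :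
    stieltjesPow (a - 1) (1 - a - c) μ = Complex.Gamma a * stieltjesClosedForm a c μ := by
  -- Induction on a bound N for Re a - 2; when Re a ≥ 2 the shifted parameter a - 1 still has
  -- positive real part.
  obtain ⟨N, hN⟩ := exists_nat_gt (a.re - 2)
  induction N generalizing a c with
  | zero => exact stieltjesPow_eq_of_re_lt_two ha (by simp at hN; linarith) hc hn hμ hμ1
  | succ N ih =>
    rcases lt_or_ge a.re 2 with h2 | h2
    · exact stieltjesPow_eq_of_re_lt_two ha h2 hc hn hμ hμ1
    · have h := ih (a := a - 1) (c := c + 1) (by simp; linarith) (by simp; linarith)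
        (fun n h => hn (n + 1) (by push_cast; linear_combination h))
        (by push_cast at hN; simp; linarith)
      rw [show 1 - (a - 1) - (c + 1) = 1 - a - c by ring] at h
      rw [stieltjesClosedForm_eq_sub (by linarith) hc hn
        (Complex.slitPlane_ne_zero (Or.inl hμ)) hμ1, ← h,
        stieltjesPow_eq_sub (by simp; linarith) (by simp; linarith) hμ,
        show -(a - 1 + (1 - a - c)) = c by ring, show -(1 - a - c) = a + c - 1 by ring]

theorem stieltjesPow_eq_of_re_eq_zero {a c μ : ℂ} (ha : 1 < a.re) (hc : 0 < c.re)
    (hn : ∀ n : ℕ, a ≠ (n : ℂ) + 1) (hμ : μ.re = 0) (hμ1 : ‖μ‖ < 1) :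
    stieltjesPow (a - 1) (1 - a - c) μ = Complex.Gamma a * stieltjesClosedForm a c μ := by
  have l1 : Tendsto (fun x : ℝ => stieltjesPow (a - 1) (1 - a - c) (μ + x)) (𝓝[>] 0)
      (𝓝 (stieltjesPow (a - 1) (1 - a - c) μ)) := by
    refine tendsto_integral_filter_of_dominated_convergence
      (fun t => ‖powKernel (a - 1) (1 - a - c) t‖ / (t + 0)) ?_ ?_
      (integrableOn_norm_powKernel_div (by simp; linarith) (by simp; linarith)) ?_
    · filter_upwards [self_mem_nhdsWithin] with x hx
      have hx' : (0 : ℝ) < x := hx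
      exact aestronglyMeasurable_powKernel_div_add _ _ (by simp; linarith)
    · filter_upwards [self_mem_nhdsWithin] with x hx
      have hx' : (0 : ℝ) < x := hx
      exact (ae_restrict_iff' measurableSet_Ioi).2
        (.of_forall fun t ht => norm_powKernel_div_add_le _ _ ht le_rfl (by simp; linarith))
    · refine (ae_restrict_iff' measurableSet_Ioi).2 (.of_forall fun t ht => ?_)
      have h : ContinuousAt
          (fun x : ℝ => powKernel (a - 1) (1 - a - c) t / ((t : ℂ) + (μ + x))) 0 := by
        refine ContinuousAt.div (by fun_prop) (by fun_prop) ?_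
        simpa using ofReal_add_ne_zero ht hμ.ge
      simpa using h.tendsto.mono_left (nhdsWithin_le_nhds (s := Ioi 0))
  have hcont : ContinuousAt (stieltjesClosedForm a c) μ := by
    have c1 := (hasSum_deriv_ordinaryHypergeometric hc
      (two_sub_ne_neg_natCast hn) hμ1).2.continuousAt
    -- The point μ = 0 is included; continuity there relies on Re(a-1) > 0.
    have c2 : ContinuousAt (fun z : ℂ => z ^ (a - 1)) μ :=
      Complex.continuousAt_cpow_const_of_re_pos (Or.inl hμ.ge) (by simp; linarith)
    have hs := one_sub_mem_slitPlane hμ1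
    have c3 : ContinuousAt (fun z : ℂ => (1 - z) ^ (a + c - 1)) μ :=
      (by fun_prop : ContinuousAt (fun z : ℂ => 1 - z) μ).cpow continuousAt_const hs
    refine (continuousAt_const.mul c1).add ((c2.mul continuousAt_const).div c3 fun h => ?_)
    exact Complex.slitPlane_ne_zero hs ((Complex.cpow_eq_zero_iff _ _).1 h).1
  have hadd : ContinuousAt (fun x : ℝ => μ + (x : ℂ)) 0 := by fun_prop
  have hc0 : ContinuousAt (stieltjesClosedForm a c) (μ + ((0 : ℝ) : ℂ)) := by simpa using hcont
  have l2 : Tendsto (fun x : ℝ => Complex.Gamma a * stieltjesClosedForm a c (μ + x)) (𝓝[>] 0)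
      (𝓝 (Complex.Gamma a * stieltjesClosedForm a c μ)) := by
    have h : ContinuousAt (fun x : ℝ => stieltjesClosedForm a c (μ + x)) 0 :=
      ContinuousAt.comp (f := fun x : ℝ => μ + (x : ℂ)) hc0 hadd
    simpa using (h.tendsto.mono_left (nhdsWithin_le_nhds (s := Ioi 0))).const_mul
      (Complex.Gamma a)
  refine tendsto_nhds_unique l1 (l2.congr' ?_)
  have hball : ∀ᶠ x : ℝ in 𝓝[>] 0, ‖μ + (x : ℂ)‖ < 1 :=
    nhdsWithin_le_nhds (hadd.norm.eventually_lt continuousAt_const (by simpa using hμ1))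
  filter_upwards [self_mem_nhdsWithin, hball] with x hx hx1
  have hx' : (0 : ℝ) < x := hx
  exact (stieltjesPow_eq (by linarith) hc hn (by simp; linarith) hx1).symm

/-! ### The value at μ = 1 and the main theorem. -/

lemma Gamma_add_natCast {c : ℂ} (hc : 0 < c.re) (k : ℕ) :
    Complex.Gamma (c + k) = (ascPochhammer ℂ k).eval c * Complex.Gamma c := by
  induction k with
  | zero => simp
  | succ k ih =>
    have : c + k ≠ 0 := by
      intro h
      have := congrArg Complex.re h
      simp at this
      linarith [(Nat.cast_nonneg k : (0 : ℝ) ≤ k)]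
    rw [ascPochhammer_succ_eval, Nat.cast_add, Nat.cast_one, ← add_assoc,
      Complex.Gamma_add_one _ this, ih]
    ring

theorem tricomiJ_one {a b : ℂ} (ha : 0 < a.re) (hb : b.re < 2) :
    TricomiJConverges a b 1 ∧
      tricomiJ a b 1 = Complex.Gamma (2 - b) / Complex.Gamma (2 - b + a) := by
  have hp : -1 < (a - 1).re := by simp; linarith
  have hpq : (a - 1).re + (b - a - 1).re < 0 := by simp; linarith
  have hI := integrableOn_norm_powKernel_div_add hp hpq (m := (1 : ℂ).re) (by simp)
  refine ⟨tricomiJConverges_of_integrableOn (by simp) hI, ?_⟩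
  have hG := Complex.Gamma_ne_zero_of_re_pos ha
  rw [tricomiJ_eq_stieltjesPow (by simp) hI, stieltjesPow_one hp hpq, sub_add_cancel,
    show -(a - 1 + (b - a - 1)) = 2 - b by ring, show 1 - (b - a - 1) = 2 - b + a by ring]
  field_simp

theorem mainTheorem7 (a b : ℂ) (ha : 0 < a.re) (hb : b.re < 2) :
    (∀ μ : ℂ, ‖μ‖ < 1 → (0 < μ.re ∨ (μ.re = 0 ∧ 1 < a.re)) → (∀ n : ℕ, a ≠ (n : ℂ) + 1) →
      TricomiJConverges a b μ ∧
      tricomiJ a b μ =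
        Complex.Gamma (2 - b) / ((a - 1) * Complex.Gamma (1 + a - b)) *
            ordinaryHypergeometric 1 (2 - b) (2 - a) μ +
          μ ^ (a - 1) * Complex.Gamma (1 - a) / (1 - μ) ^ (1 + a - b)) ∧
    (TricomiJConverges a b 1 ∧
      tricomiJ a b 1 = Complex.Gamma (2 - b) / Complex.Gamma (2 - b + a)) ∧
    (∀ k : ℕ, 1 ≤ k → a = (k : ℂ) →
      tricomiJ a b 1 = 1 / (ascPochhammer ℂ k).eval (2 - b)) := by
  have hc : 0 < (2 - b).re := by simp; linarith
  have hG := Complex.Gamma_ne_zero_of_re_pos ha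
  have hpq : (a - 1).re + (b - a - 1).re < 0 := by simp; linarith
  refine ⟨fun μ hμ1 hμ hn => ?_, tricomiJ_one ha hb, fun k _ hk => ?_⟩
  · have hμ0 : 0 ≤ μ.re := by
      rcases hμ with h | h
      · exact h.le
      · exact h.1.ge
    have hI : IntegrableOn
        (fun t : ℝ => ‖powKernel (a - 1) (b - a - 1) t‖ / (t + μ.re)) (Ioi 0) := by
      rcases hμ with h | ⟨h, h1⟩
      · exact integrableOn_norm_powKernel_div_add (by simp; linarith) hpq h
      · rw [h]
        exact integrableOn_norm_powKernel_div (by simp; linarith) hpq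
    refine ⟨tricomiJConverges_of_integrableOn hμ0 hI, ?_⟩
    have hS : stieltjesPow (a - 1) (b - a - 1) μ =
        Complex.Gamma a * stieltjesClosedForm a (2 - b) μ := by
      rw [show b - a - 1 = 1 - a - (2 - b) by ring]
      rcases hμ with h | ⟨h, h1⟩
      · exact stieltjesPow_eq ha hc hn h hμ1
      · exact stieltjesPow_eq_of_re_eq_zero h1 hc hn h hμ1
    rw [tricomiJ_eq_stieltjesPow hμ0 hI, hS, ← mul_assoc, one_div_mul_cancel hG, one_mul,
      stieltjesClosedForm, show a + (2 - b) - 1 = 1 + a - b by ring]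
  · have hGc := Complex.Gamma_ne_zero_of_re_pos hc
    rw [(tricomiJ_one ha hb).2, hk, Gamma_add_natCast hc]
    field_simp
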